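/- **Setting.** Let $\Omega\subset\mathbb R^2$ be a polygonal open set, $T>0$, $\mathrm{Re}>0$, and let $\mathbf f:[0,T]\to \mathbf L^2(\Omega)=L^2(\Omega)^2$ be such that $t\mapsto|\mathbf f(t)|$ is continuous on $[0,T]$, where $|\cdot|$ is the $L^2(\Omega)$ norm. *Mesh.* A mesh $\mathcal T_h$ of $\Omega$ is a finite set of closed triangles, with all interior angles $<\pi/2$, such that $\Omega$ is the interior of their union and any two of them meet exactly in the convex hull of their common vertices. Write $|K|$ for the area and $\mathbf x_K$ for the circumcenter of $K\in\mathcal T_h$, $\mathcal E_K$ for its set of edges, and $\mathbf n_{K,\sigma}$ for the unit normal to $\sigma\in\mathcal E_K$ pointing outward $K$; write $|\sigma|$ for the length and $\mathbf x_\sigma$ for the midpoint of an edge. An edge is interior ($\sigma\in\mathcal E_h^{int}$) if it is shared by two triangles $K_\sigma,L_\sigma$, and exterior ($\sigma\in\mathcal E_h^{ext}$) if it belongs to one triangle $K_\sigma$ only. In a formula attached to a triangle $K$ and an interior edge $\sigma\in\mathcal E_K$, $L_\sigma$ is the triangle on the other side of $\sigma$. Set $d_\sigma=|\mathbf x_{K_\sigma}-\mathbf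 x_{L_\sigma}|$ for $\sigma\in\mathcal E_h^{int}$, $d_\sigma=|\mathbf x_{K_\sigma}-\mathbf x_\sigma|$ for $\sigma\in\mathcal E_h^{ext}$, and $\tau_\sigma=|\sigma|/d_\sigma$. *Spaces.* $\mathbf P_0$ is the space of vector fields $\mathbf v_h$ equal to a constant $\mathbf v_K\in\mathbb R^2$ on each $K$; thus $|\mathbf v_h|^2=\sum_K|K||\mathbf v_K|^2$, and $$\|\mathbf v_h\|_h^2=\sum_{\sigma\in\mathcal E_h^{int}}\tau_\sigma|\mathbf v_{L_\sigma}-\mathbf v_{K_\sigma}|^2+\sum_{\sigma\in\mathcal E_h^{ext}}\tau_\sigma|\mathbf v_{K_\sigma}|^2 .$$ $P_1^{nc}$ is the space of functions that are affine on each triangle and continuous at the midpoints of the interior edges; $L^2_0$ is the set of $q\in L^2(\Omega)$ with $\int_\Omega q=0$. $\mathbf P_0\cap\mathbf{RT_0}$ is the set of $\mathbf v_h\in\mathbf P_0$ with $\mathbf v_{K_\sigma}\cdot\mathbf n_{K_\sigma,\sigma}=\mathbf v_{L_\sigma}\cdot\mathbf n_{K_\sigma,\sigma}$ for $\sigma\in\mathcal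 E_h^{int}$ and $\mathbf v_{K_\sigma}\cdot\mathbf n_{K_\sigma,\sigma}=0$ for $\sigma\in\mathcal E_h^{ext}$. $\Pi_{\mathbf P_0}\mathbf w\in\mathbf P_0$ is given by the mean values of $\mathbf w$ over the triangles. *Operators.* $\nabla_h:P_1^{nc}\to\mathbf P_0$ is the gradient on each triangle. $\mathrm{div}_h:\mathbf P_0\to P_1^{nc}$ is given by $$(\mathrm{div}_h\mathbf v_h)(\mathbf x_\sigma)=\frac{3|\sigma|}{|K_\sigma|+|L_\sigma|}(\mathbf v_{L_\sigma}-\mathbf v_{K_\sigma})\cdot\mathbf n_{K_\sigma,\sigma}\ (\sigma\in\mathcal E_h^{int}),\qquad (\mathrm{div}_h\mathbf v_h)(\mathbf x_\sigma)=-\frac{3|\sigma|}{|K_\sigma|}\mathbf v_{K_\sigma}\cdot\mathbf n_{K_\sigma,\sigma}\ (\sigma\in\mathcal E_h^{ext}),$$ and $\Delta_h=\mathrm{div}_h\nabla_h$. For $\mathbf v_h\in\mathbf P_0$ and $\mathbf u_h\in\mathbf P_0\cap\mathbf{RT_0}$, with $a^+=\max(a,0)$ and $a^-=\min(a,0)$,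 $$\widetilde\Delta_h\mathbf v_h|_K=\frac1{|K|}\sum_{\sigma\in\mathcal E_K\cap\mathcal E_h^{int}}\tau_\sigma(\mathbf v_{L_\sigma}-\mathbf v_K)-\frac1{|K|}\sum_{\sigma\in\mathcal E_K\cap\mathcal E_h^{ext}}\tau_\sigma\mathbf v_K,$$ $$\widetilde{\mathbf b}_h(\mathbf u_h,\mathbf v_h)|_K=\frac1{|K|}\sum_{\sigma\in\mathcal E_K\cap\mathcal E_h^{int}}|\sigma|\big((\mathbf u_K\cdot\mathbf n_{K,\sigma})^+\mathbf v_K+(\mathbf u_K\cdot\mathbf n_{K,\sigma})^-\mathbf v_{L_\sigma}\big).$$ *Scheme.* Let $k>0$ and $N\in\mathbb N$ with $Nk\le T$, and set $t_n=nk$, $\mathbf f_h^n=\Pi_{\mathbf P_0}\mathbf f(t_n)$. The initial values are $\mathbf u_h^0,\mathbf u_h^1\in\mathbf P_0\cap\mathbf{RT_0}$ and $p_h^1\in P_1^{nc}\cap L^2_0$. For $1\le n\le N-1$, the fields $\tilde{\mathbf u}_h^{n+1}\in\mathbf P_0$, $p_h^{n+1}\in P_1^{nc}\cap L_0^2$ and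 $\mathbf u_h^{n+1}\in\mathbf P_0$ satisfy $$\frac{3\tilde{\mathbf u}^{n+1}_h-4\mathbf u^n_h+\mathbf u^{n-1}_h}{2k}-\frac1{\mathrm{Re}}\widetilde\Delta_h\tilde{\mathbf u}_h^{n+1}+\widetilde{\mathbf b}_h(2\mathbf u_h^n-\mathbf u_h^{n-1},\tilde{\mathbf u}_h^{n+1})+\nabla_hp_h^n=\mathbf f_h^{n+1},$$ $$\Delta_h(p_h^{n+1}-p_h^n)=\frac3{2k}\mathrm{div}_h\tilde{\mathbf u}_h^{n+1},\qquad \mathbf u_h^{n+1}=\tilde{\mathbf u}_h^{n+1}-\frac{2k}3\nabla_h(p_h^{n+1}-p_h^n).$$ **Theorem 5.1.** For every constant $C_0$ there is a constant $C>0$, depending only on $\Omega$, $T$, $\mathrm{Re}$, $\mathbf f$ and $C_0$ (and not on the mesh, $k$, $N$ or the initial values), such that for every mesh of $\Omega$, all $k$ and $N$ as above and all initial values satisfying $$\textbf{(H1)}\qquad |\mathbf u_h^0|+|\mathbf u_h^1|+k|\nabla_hp_h^1|\le C_0,$$ the scheme satisfies, for all $m\in\{2,\dots,N\}$, $$|\mathbf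 u_h^m|^2+k\sum_{n=2}^m\|\tilde{\mathbf u}_h^n\|_h^2\le C .$$ -/

import Mathlib

open MeasureTheory Set
open scoped Gradient

noncomputable section

namespace FVScheme

/-- The Euclidean plane. -/
abbrev Plane : Type := EuclideanSpace ℝ (Fin 2)

/-- A (conforming) triangular mesh of the polygonal open set `Ω`, made of finitely many closed
triangles `(cell K).closedInterior` all of whose interior angles are less than `π / 2`. Two
triangles meet exactly in the convex hull of their common vertices (nothing, a vertex or an edge),
and `Ω` is the interior of the union of the closed triangles. -/
structure TriMesh (Ω : Set Plane) where
  /-- the number of triangles -/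
  numCells : ℕ
  /-- the triangles -/
  cell : Fin numCells → Affine.Triangle ℝ Plane
  acute : ∀ K, (cell K).AcuteAngled
  vertices_injective : Function.Injective fun K => range (cell K).points
  conforming : ∀ K L, (cell K).closedInterior ∩ (cell L).closedInterior =
    convexHull ℝ (range (cell K).points ∩ range (cell L).points)
  interior_iUnion : interior (⋃ K, (cell K).closedInterior) = Ω

namespace TriMesh

variable {Ω : Set Plane} (M : TriMesh Ω)

/-- Indices of the triangles. -/
abbrev Cell : Type := Fin M.numCells

/-- The closed triangle `K`, as a set. -/
def cellSet (K : M.Cell) : Set Plane := (M.cell K).closedInterior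

/-- The area `|K|`. -/
def area (K : M.Cell) : ℝ := volume.real (M.cellSet K)

/-- The center `x_K` of the circumscribed circle of `K`. -/
def center (K : M.Cell) : Plane := (M.cell K).circumcenter

/-- The edge of `K` opposite to its `i`-th vertex, as an unordered pair of points. -/
def edgePair (K : M.Cell) (i : Fin 3) : Sym2 Plane :=
  s((M.cell K).points (i + 1), (M.cell K).points (i + 2))

open Classical in
/-- The finite set of all the edges of the mesh. -/
def edges : Finset (Sym2 Plane) :=
  Finset.univ.image fun a : M.Cell × Fin 3 => M.edgePair a.1 a.2

/-- The type of the edges of the mesh. -/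
abbrev Edge : Type := {σ : Sym2 Plane // σ ∈ M.edges}

/-- The edge of `K` opposite to its `i`-th vertex. The edges of `K` are
`M.edge K 0`, `M.edge K 1`, `M.edge K 2`. -/
def edge (K : M.Cell) (i : Fin 3) : M.Edge :=
  ⟨M.edgePair K i, by
    classical
    exact Finset.mem_image.2 ⟨(K, i), Finset.mem_univ _, rfl⟩⟩

open Classical in
/-- The triangles having `σ` as an edge: two triangles if `σ` lies inside `Ω`, one triangle if `σ`
lies on the boundary of `Ω`. -/
def adj (σ : M.Edge) : Finset M.Cell := {K | ∃ i, M.edge K i = σ}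

theorem adj_nonempty (σ : M.Edge) : (M.adj σ).Nonempty := by
  classical
  obtain ⟨⟨K, i⟩, -, h⟩ := Finset.mem_image.1 σ.2
  exact ⟨K, by
    unfold adj
    exact Finset.mem_filter.2 ⟨Finset.mem_univ _, i, Subtype.ext h⟩⟩

/-- Interior edges: those shared by two triangles. The other ones are the exterior edges. -/
def IsInterior (σ : M.Edge) : Prop := 1 < (M.adj σ).card

/-- The triangle `K_σ`. For an interior edge the two adjacent triangles are enumerated
in the order of their indices. -/
def cellK (σ : M.Edge) : M.Cell := (M.adj σ).min' (M.adj_nonempty σ)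

/-- The triangle `L_σ` (only meaningful, and only used, for an interior edge). -/
def cellL (σ : M.Edge) : M.Cell := (M.adj σ).max' (M.adj_nonempty σ)

/-- The triangle on the other side of the interior edge `σ` of `K`. -/
def other (K : M.Cell) (σ : M.Edge) : M.Cell := if K = M.cellK σ then M.cellL σ else M.cellK σ

/-- The length `|σ|`. -/
def len (σ : M.Edge) : ℝ := Sym2.lift ⟨fun a b : Plane => dist a b, fun a b => dist_comm a b⟩ σ.1

/-- The midpoint `x_σ`. -/
def mid (σ : M.Edge) : Plane := Sym2.lift ⟨fun a b : Plane => midpoint ℝ a b, fun a b => midpoint_comm a b⟩ σ.1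

open Classical in
/-- `d_σ = d(x_{K_σ}, x_{L_σ})` for an interior edge, `d_σ = d(x_{K_σ}, x_σ)` for an exterior
edge. -/
def d (σ : M.Edge) : ℝ :=
  if M.IsInterior σ then dist (M.center (M.cellK σ)) (M.center (M.cellL σ))
  else dist (M.center (M.cellK σ)) (M.mid σ)

/-- The transmissivity `τ_σ = |σ| / d_σ`. -/
def tau (σ : M.Edge) : ℝ := M.len σ / M.d σ

/-- The unit vector normal to the edge of `K` opposite to its `i`-th vertex, pointing outward `K`:
the normalized altitude, directed from the vertex to its foot on the line of the edge. -/
def outward (K : M.Cell) (i : Fin 3) : Plane :=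
  ‖(M.cell K).altitudeFoot i - (M.cell K).points i‖⁻¹ •
    ((M.cell K).altitudeFoot i - (M.cell K).points i)

open Classical in
/-- The outward unit normal `n_{K,σ}`, for an edge `σ` of `K` (zero if `σ` is not an edge of `K`:
exactly one term of the sum remains if it is). -/
def normal (K : M.Cell) (σ : M.Edge) : Plane :=
  ∑ i, if M.edge K i = σ then M.outward K i else 0

/-- Vector fields that are constant on each triangle, given by their values. -/
abbrev P0 : Type := M.Cell → Plane

/-- The `L²(Ω)` norm of a piecewise constant field. -/
def l2norm (v : M.P0) : ℝ := √(∑ K, M.area K * ‖v K‖ ^ 2)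

open Classical in
/-- The discrete `H¹` norm `‖v‖_h`. -/
def h1norm (v : M.P0) : ℝ :=
  √((∑ σ : M.Edge with M.IsInterior σ, M.tau σ * ‖v (M.cellL σ) - v (M.cellK σ)‖ ^ 2) +
    ∑ σ : M.Edge with ¬ M.IsInterior σ, M.tau σ * ‖v (M.cellK σ)‖ ^ 2)

/-- The projection on the piecewise constant fields: the mean values over the triangles. -/
def proj0 (w : Plane → Plane) : M.P0 := fun K => (M.area K)⁻¹ • ∫ x in M.cellSet K, w x

/-- Functions that are affine on each triangle, given by their affine pieces. -/
abbrev P1 : Type := M.Cell → (Plane →ᵃ[ℝ] ℝ)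

/-- Membership in `P₁^nc`: continuity at the midpoints of the interior edges. -/
def IsP1nc (q : M.P1) : Prop :=
  ∀ σ : M.Edge, M.IsInterior σ → q (M.cellK σ) (M.mid σ) = q (M.cellL σ) (M.mid σ)

/-- Membership in `L²₀`: the integral over `Ω` vanishes. -/
def HasZeroMean (q : M.P1) : Prop := ∑ K, ∫ x in M.cellSet K, q K x = 0

/-- The discrete gradient `∇_h`, with values in the piecewise constant fields. -/
def grad (q : M.P1) : M.P0 := fun K => (M.area K)⁻¹ • ∫ x in M.cellSet K, ∇ (q K) x

open Classical in
/-- The discrete divergence `div_h v ∈ P₁^nc`, given by its values at the midpoints `x_σ` of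
all the edges (these values determine an element of `P₁^nc`, and they can be prescribed). -/
def div (v : M.P0) (σ : M.Edge) : ℝ :=
  if M.IsInterior σ then
    3 * M.len σ / (M.area (M.cellK σ) + M.area (M.cellL σ)) *
      inner ℝ (v (M.cellL σ) - v (M.cellK σ)) (M.normal (M.cellK σ) σ)
  else
    -(3 * M.len σ / M.area (M.cellK σ) *
      inner ℝ (v (M.cellK σ)) (M.normal (M.cellK σ) σ))

/-- The first discrete laplacian `Δ_h q = div_h (∇_h q)`, given by its values at the
midpoints of the edges. -/
def lap (q : M.P1) (σ : M.Edge) : ℝ := M.div (M.grad q) σ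

open Classical in
/-- The second discrete laplacian, from the piecewise constant fields to themselves. -/
def lapTilde (v : M.P0) : M.P0 := fun K =>
  (M.area K)⁻¹ • (∑ i : Fin 3 with M.IsInterior (M.edge K i),
      M.tau (M.edge K i) • (v (M.other K (M.edge K i)) - v K)) -
  (M.area K)⁻¹ • ∑ i : Fin 3 with ¬ M.IsInterior (M.edge K i), M.tau (M.edge K i) • v K

/-- Membership of a piecewise constant field in the Raviart-Thomas space `RT₀`: the normal
component is continuous across the interior edges and vanishes on the boundary. -/
def IsRT0 (v : M.P0) : Prop :=
  ∀ σ : M.Edge,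
    (M.IsInterior σ → inner ℝ (v (M.cellK σ)) (M.normal (M.cellK σ) σ) =
      inner ℝ (v (M.cellL σ)) (M.normal (M.cellK σ) σ)) ∧
    (¬ M.IsInterior σ → inner ℝ (v (M.cellK σ)) (M.normal (M.cellK σ) σ) = 0)

open Classical in
/-- The upwind discretization `b̃_h(u, v)` of the convection term. -/
def bTilde (u v : M.P0) : M.P0 := fun K =>
  (M.area K)⁻¹ • ∑ i : Fin 3 with M.IsInterior (M.edge K i),
    M.len (M.edge K i) •
      (max (inner ℝ (u K) (M.normal K (M.edge K i))) 0 • v K +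
        min (inner ℝ (u K) (M.normal K (M.edge K i))) 0 • v (M.other K (M.edge K i)))

/-- `(u, ũ, p)` is produced by the BDF2 projection finite volume scheme with Reynolds number
`Re`, time step `k`, times `t_n = n k` for `0 ≤ n ≤ N` and forcing term `f`. The entries `ũ⁰`, `ũ¹`,
`p⁰`, and all the entries after the index `N`, play no role. -/
structure IsSolution (Re k : ℝ) (N : ℕ) (f : ℝ → Plane → Plane)
    (u ut : ℕ → M.P0) (p : ℕ → M.P1) : Prop where
  u_zero : M.IsRT0 (u 0)
  u_one : M.IsRT0 (u 1)
  p_one : M.IsP1nc (p 1) ∧ M.HasZeroMean (p 1)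
  momentum : ∀ n, 1 ≤ n → n + 1 ≤ N →
    (2 * k)⁻¹ • ((3 : ℝ) • ut (n + 1) - (4 : ℝ) • u n + u (n - 1))
      - (1 / Re) • M.lapTilde (ut (n + 1))
      + M.bTilde ((2 : ℝ) • u n - u (n - 1)) (ut (n + 1))
      + M.grad (p n) = M.proj0 (f ((n + 1 : ℕ) * k))
  pressure_mem : ∀ n, 1 ≤ n → n + 1 ≤ N → M.IsP1nc (p (n + 1)) ∧ M.HasZeroMean (p (n + 1))
  pressure : ∀ n, 1 ≤ n → n + 1 ≤ N → ∀ σ : M.Edge,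
    M.lap (p (n + 1) - p n) σ = 3 / (2 * k) * M.div (ut (n + 1)) σ
  projection : ∀ n, 1 ≤ n → n + 1 ≤ N →
    u (n + 1) = ut (n + 1) - (2 * k / 3) • M.grad (p (n + 1) - p n)

end TriMesh

end FVScheme

end

/-! Testing the momentum equation with `4k ũⁿ⁺¹` gives an energy estimate. The projection step puts
every `uⁿ` in `RT₀` (`IsSolution.isRT0`), hence makes it orthogonal to gradients of `P₁^nc`
functions (`ip_grad_eq_zero`). In `energy_step` the BDF2 difference becomes an increment of |uⁿ|² +
|2uⁿ - uⁿ⁻¹|² plus squares, the pressure term an increment of (4k²/3)|∇pⁿ|² minus a smaller square,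
the Laplacian yields ‖ũⁿ⁺¹‖_h² (`ip_lapTilde`), and upwind convection is nonnegative
(`ip_bTilde_nonneg`).

The forcing contributes at most 4kF|ũⁿ⁺¹|, and |ũⁿ⁺¹|² is itself controlled by the left-hand side.
Hence the square root of the energy grows by at most 4kF per step (`le_sq_of_le_add_mul`). As nk ≤
T, this closes with no Gronwall or Poincaré inequality and no restriction on k.

Summation by edges needs the normals of two triangles sharing an edge to be opposite
(`normal_eq_neg`), which also excludes a third triangle (`IsInterior.eq_or_eq`). Both rest on
conformity of the mesh. -/

noncomputable section

namespace FVScheme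

/-! ### Triangles on the same side of a common edge -/

/-- The determinant of two plane vectors. -/
def cross (v w : Plane) : ℝ := v 0 * w 1 - v 1 * w 0

theorem inner_eq (v w : Plane) : inner ℝ v w = v 0 * w 0 + v 1 * w 1 := by
  simp [PiLp.inner_apply, Fin.sum_univ_two, mul_comm]

theorem norm_sq_eq (v : Plane) : ‖v‖ ^ 2 = v 0 ^ 2 + v 1 ^ 2 := by
  rw [← real_inner_self_eq_norm_sq, inner_eq]; ring

/-- Two triangles with a common side `bc` and apexes on the same side of it have a common point off
the line `bc`. -/
theorem exists_mem_inter_of_same_side {a a' b c : Plane}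
    (h : 0 < cross (b - a) (c - b) * cross (b - a') (c - b)) :
    ∃ x ∈ convexHull ℝ {a, b, c} ∩ convexHull ℝ {a', b, c}, cross (x - b) (c - b) ≠ 0 := by
  set D := cross (b - a) (c - b) with hD
  set D' := cross (b - a') (c - b) with hD'
  have hD0 : D ≠ 0 := fun h0 => by simp [h0] at h
  have hD0' : D' ≠ 0 := fun h0 => by simp [h0] at h
  have he : c - b ≠ 0 := fun h0 => hD0 (by rw [hD, h0]; simp [cross])
  have hE : 0 < ‖c - b‖ ^ 2 := by positivity
  set E := ‖c - b‖ ^ 2 with hEdef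
  set α := D' / D with hα
  have hαpos : 0 < α := by
    rw [hα, div_eq_mul_inv]
    have : D' * D⁻¹ = D * D' * (D⁻¹) ^ 2 := by field_simp
    rw [this]; positivity
  set m : Plane := midpoint ℝ b c with hm
  -- Modulo the direction of `bc`, `a' - m` is a positive multiple of `a - m`. A short move from `m`
  -- towards `a'` therefore enters both triangles.
  obtain ⟨β, hβ⟩ : ∃ β : ℝ, a' - m = α • (a - m) + β • (c - b) := by
    refine ⟨inner ℝ (a' - m - α • (a - m)) (c - b) / E, ?_⟩
    have hαD : α * D = D' := by rw [hα]; field_simp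
    have h0 : ∀ j : Fin 2, m j = (b j + c j) / 2 := by
      intro j
      simp [hm, midpoint_eq_smul_add]
      ring
    rw [inner_eq]
    simp only [cross, PiLp.sub_apply] at hD hD'
    rw [norm_sq_eq] at hEdef
    simp only [PiLp.sub_apply] at hEdef
    rw [hD, hD'] at hαD
    clear_value α
    clear hα
    ext j
    fin_cases j
    · simp only [Fin.zero_eta, PiLp.sub_apply, PiLp.add_apply, PiLp.smul_apply, smul_eq_mul, h0]
      rw [div_mul_eq_mul_div, ← sub_eq_iff_eq_add', eq_div_iff hE.ne', hEdef]
      linear_combination (c 1 - b 1) * hαD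
    · simp only [Fin.mk_one, PiLp.sub_apply, PiLp.add_apply, PiLp.smul_apply, smul_eq_mul, h0]
      rw [div_mul_eq_mul_div, ← sub_eq_iff_eq_add', eq_div_iff hE.ne', hEdef]
      linear_combination -(c 0 - b 0) * hαD
  -- Small enough that ε ≤ 1 and ε(α + 2|β|) ≤ 1, which keeps all barycentric coordinates below
  -- nonnegative.
  set ε : ℝ := (1 + α + 2 * |β|)⁻¹ with hε
  have hden : 0 < 1 + α + 2 * |β| := by positivity
  have hεpos : 0 < ε := by positivity
  have hε1 : ε * (1 + α + 2 * |β|) = 1 := inv_mul_cancel₀ hden.ne'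
  have hβ1 := neg_abs_le β
  have hβ2 := le_abs_self β
  have hβ0 := abs_nonneg β
  have key : ∀ (q : Plane) (x y z : ℝ), 0 ≤ x → 0 ≤ y → 0 ≤ z → x + y + z = 1 →
      x • q + y • b + z • c ∈ convexHull ℝ {q, b, c} := by
    intro q x y z hx hy hz hs
    rw [convexHull_insert (by simp), convexHull_pair]
    rcases eq_or_lt_of_le (add_nonneg hy hz) with h0 | h0
    · have : y = 0 := by linarith
      have : z = 0 := by linarith
      have : x = 1 := by linarith
      subst_vars
      simp only [one_smul, zero_smul, add_zero]
      exact subset_convexJoin_left (by exact ⟨b, left_mem_segment ℝ b c⟩) (mem_singleton q)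
    · rw [mem_convexJoin]
      refine ⟨q, rfl, (y / (y + z)) • b + (z / (y + z)) • c,
        ⟨_, _, by positivity, by positivity, by field_simp, rfl⟩,
        ⟨x, y + z, hx, h0.le, by linarith, ?_⟩⟩
      rw [smul_add, smul_smul, smul_smul, mul_div_cancel₀ _ h0.ne', mul_div_cancel₀ _ h0.ne',
        add_assoc]
  have hmm : m = (1 / 2 : ℝ) • b + (1 / 2 : ℝ) • c := by
    rw [hm, midpoint_eq_smul_add, smul_add]; simp
  refine ⟨m + ε • (a' - m), ⟨?_, ?_⟩, ?_⟩
  · have : m + ε • (a' - m) = (ε * α) • a + ((1 - ε * α) / 2 - ε * β) • b +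
        ((1 - ε * α) / 2 + ε * β) • c := by
      rw [hβ, hmm]; module
    rw [this]
    refine key _ _ _ _ (by positivity) ?_ ?_ (by ring)
    · nlinarith
    · nlinarith
  · have : m + ε • (a' - m) = ε • a' + ((1 - ε) / 2) • b + ((1 - ε) / 2) • c := by
      rw [hmm]; module
    rw [this]
    have : ε ≤ 1 := by nlinarith
    exact key _ _ _ _ hεpos.le (by linarith) (by linarith) (by ring)
  · have : cross (m + ε • (a' - m) - b) (c - b) = - ε * D' := by
      rw [hmm, hD']
      simp [cross]
      ring
    rw [this]
    exact mul_ne_zero (by linarith) hD0'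

/-! ### Areas and determinants -/

/-- The Lebesgue measure of the reference triangle, relative to which areas are computed. -/
def refArea : ℝ := volume.real (convexHull ℝ (range (![0, EuclideanSpace.single 0 1,
  EuclideanSpace.single 1 1] : Fin 3 → Plane)))

/-- Twice the signed area of a triangle. -/
def det (t : Affine.Triangle ℝ Plane) : ℝ :=
  cross (t.points 1 - t.points 0) (t.points 2 - t.points 0)

/-- The triangle is an affine image of the reference one, and the linear part has determinant `det
t`. The numerical value of `refArea` is never needed. -/
theorem measureReal_closedInterior (t : Affine.Triangle ℝ Plane) :
    volume.real t.closedInterior = |det t| * refArea := by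
  set B := (EuclideanSpace.basisFun (Fin 2) ℝ).toBasis with hB
  set A : Matrix (Fin 2) (Fin 2) ℝ := fun i j =>
    if j = 0 then t.points 1 i - t.points 0 i else t.points 2 i - t.points 0 i with hA
  set L := Matrix.toLin B B A with hL
  have hdet : LinearMap.det L = det t := by
    rw [hL, LinearMap.det_toLin, Matrix.det_fin_two]
    simp [hA, det, cross]; ring
  have hL0 : L (EuclideanSpace.single 0 1) = t.points 1 - t.points 0 := by
    have := Matrix.toLin_self B B A 0
    simp [hB] at this
    rw [hL, hB, this]
    ext j
    fin_cases j <;> simp [hA]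
  have hL1 : L (EuclideanSpace.single 1 1) = t.points 2 - t.points 0 := by
    have := Matrix.toLin_self B B A 1
    simp [hB] at this
    rw [hL, hB, this]
    ext j
    fin_cases j <;> simp [hA]
  have himg : t.closedInterior = (fun x => t.points 0 + x) '' (L '' convexHull ℝ (range
      (![0, EuclideanSpace.single 0 1, EuclideanSpace.single 1 1] : Fin 3 → Plane))) := by
    rw [← Affine.Simplex.convexHull_eq_closedInterior, LinearMap.image_convexHull,
      ← range_comp]
    have h2 := (AffineEquiv.constVAdd ℝ Plane (t.points 0)).toAffineMap.image_convexHull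
      (range (L ∘ ![0, EuclideanSpace.single 0 1, EuclideanSpace.single 1 1]))
    have h3 : ((AffineEquiv.constVAdd ℝ Plane (t.points 0)).toAffineMap : Plane → Plane) =
      fun x => t.points 0 + x := by
      ext x; simp
    rw [h3] at h2
    rw [h2, ← range_comp]
    congr 2
    ext i : 1
    fin_cases i <;> simp [hL0, hL1]
  rw [himg, measureReal_def, image_add_left, measure_preimage_add, Measure.addHaar_image_linearMap,
    ENNReal.toReal_mul, hdet, ENNReal.toReal_ofReal (abs_nonneg _)]
  rfl

theorem measureReal_closedInterior_pos (t : Affine.Triangle ℝ Plane) :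
    0 < volume.real t.closedInterior := by
  have h1 : (interior t.closedInterior).Nonempty := by
    rw [← Affine.Simplex.convexHull_eq_closedInterior,
      interior_convexHull_nonempty_iff_affineSpan_eq_top,
      t.independent.affineSpan_eq_top_iff_card_eq_finrank_add_one]
    simp
  have h2 : 0 < volume t.closedInterior := Measure.measure_pos_of_nonempty_interior _ h1
  exact ENNReal.toReal_pos h2.ne' t.isCompact_closedInterior.measure_lt_top.ne

theorem det_eq_cross (t : Affine.Triangle ℝ Plane) (i : Fin 3) :
    det t = cross (t.points (i + 1) - t.points i) (t.points (i + 2) - t.points (i + 1)) := by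
  fin_cases i <;> simp [det, cross] <;> ring

theorem det_ne_zero (t : Affine.Triangle ℝ Plane) : det t ≠ 0 := by
  have h := measureReal_closedInterior_pos t
  rw [measureReal_closedInterior] at h
  intro h0
  simp [h0] at h

theorem points_injective (t : Affine.Triangle ℝ Plane) : Function.Injective t.points :=
  t.independent.injective

namespace TriMesh

variable {Ω : Set Plane} (M : TriMesh Ω)

/-! ### Edge lengths and outward normals -/

theorem area_pos (K : M.Cell) : 0 < M.area K := measureReal_closedInterior_pos _

theorem len_edge (K : M.Cell) (i : Fin 3) :
    M.len (M.edge K i) = ‖(M.cell K).points (i + 2) - (M.cell K).points (i + 1)‖ := by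
  simp only [len, edge, edgePair, Sym2.lift_mk]
  rw [dist_comm, dist_eq_norm]

theorem len_pos (σ : M.Edge) : 0 < M.len σ := by
  obtain ⟨K, hK⟩ := M.adj_nonempty σ
  classical
  obtain ⟨i, rfl⟩ := (Finset.mem_filter.1 hK).2
  rw [len_edge, norm_pos_iff, sub_ne_zero]
  intro h
  have := points_injective _ h
  revert this
  fin_cases i <;> decide

/-- The orientation of a triangle. -/
def orient (K : M.Cell) : ℝ := SignType.sign (det (M.cell K))

theorem orient_mul_det (K : M.Cell) : M.orient K * det (M.cell K) = |det (M.cell K)| := by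
  rw [orient, sign_mul_self]

theorem orient_mul_self (K : M.Cell) : M.orient K * M.orient K = 1 := by
  rcases (det_ne_zero (M.cell K)).lt_or_gt with h | h <;> simp [orient, h]

/-- The vector |σ|n is the edge vector turned by a right angle, the orientation selecting the
outward side. This removes altitude feet and leaves polynomials in the vertices. -/
theorem len_mul_inner_outward (K : M.Cell) (i : Fin 3) (w : Plane) :
    M.len (M.edge K i) * inner ℝ w (M.outward K i) = M.orient K *
      cross w ((M.cell K).points (i + 2) - (M.cell K).points (i + 1)) := by
  have hi1 : i ≠ i + 1 := by fin_cases i <;> decide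
  have hi2 : i ≠ i + 2 := by fin_cases i <;> decide
  have h1 : inner ℝ ((M.cell K).points (i + 1) - (M.cell K).altitudeFoot i)
      ((M.cell K).points i - (M.cell K).altitudeFoot i) = 0 :=
    (M.cell K).inner_vsub_altitudeFoot_vsub_altitudeFoot_eq_zero hi1
  have h2 : inner ℝ ((M.cell K).points (i + 2) - (M.cell K).altitudeFoot i)
      ((M.cell K).points i - (M.cell K).altitudeFoot i) = 0 :=
    (M.cell K).inner_vsub_altitudeFoot_vsub_altitudeFoot_eq_zero hi2
  have hne := (M.cell K).ne_altitudeFoot i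
  have hdet := det_eq_cross (M.cell K) i
  have hlen := M.len_edge K i
  have hlpos := M.len_pos (M.edge K i)
  have hdet0 := det_ne_zero (M.cell K)
  have hor := M.orient_mul_det K
  have hor2 := M.orient_mul_self K
  simp only [outward]
  set l := M.len (M.edge K i)
  set s := M.orient K
  set D := det (M.cell K)
  set p := (M.cell K).points i
  set b := (M.cell K).points (i + 1)
  set c := (M.cell K).points (i + 2)
  set q := (M.cell K).altitudeFoot i
  have hq : 0 < ‖q - p‖ := norm_pos_iff.2 (sub_ne_zero.2 hne.symm)
  set H := ‖q - p‖ with hH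
  have hl2 : l ^ 2 = (c 0 - b 0) ^ 2 + (c 1 - b 1) ^ 2 := by rw [hlen, norm_sq_eq]; rfl
  have hH2 : H ^ 2 = (q 0 - p 0) ^ 2 + (q 1 - p 1) ^ 2 := by rw [hH, norm_sq_eq]; rfl
  clear_value H l
  rw [inner_smul_right]
  simp only [inner_eq, cross, PiLp.sub_apply] at *
  -- `x` is the determinant of the edge and altitude vectors. Their orthogonality gives x² = (lH)².
  -- Since `b - q` is parallel to the edge, also x = -D.
  set x := (c 0 - b 0) * (q 1 - p 1) - (c 1 - b 1) * (q 0 - p 0) with hx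
  have e1 : x ^ 2 = (l * H) ^ 2 := by
    rw [mul_pow, hl2, hH2, hx]
    linear_combination -((c 0 - b 0) * (q 0 - p 0) + (c 1 - b 1) * (q 1 - p 1)) * (h1 - h2)
  have e2 : x * (x + D) = 0 := by
    have : x * x = - D * x := by
      rw [← sq, e1, mul_pow, hl2, hH2, hdet, hx]
      linear_combination (((c 0 - b 0) ^ 2 + (c 1 - b 1) ^ 2)) * h1
        + ((b 0 - p 0) * (c 0 - b 0) + (b 1 - p 1) * (c 1 - b 1)) * (h1 - h2)
    linear_combination this
  have hx0 : x ≠ 0 := by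
    intro h0
    rw [h0] at e1
    have : 0 < (l * H) ^ 2 := by positivity
    linarith [e1]
  have e3 : x = - D := by
    rcases mul_eq_zero.1 e2 with h | h
    · exact absurd h hx0
    · linarith
  have e4 : l * H = s * D := by
    rw [hor, ← abs_of_pos (show 0 < l * H by positivity), ← sq_eq_sq_iff_abs_eq_abs, ← e1, e3]
    ring
  -- The altitude vector is `D / l²` times the rotated edge vector.
  have e5 : ∀ u v : ℝ, l ^ 2 * (u * (q 0 - p 0) + v * (q 1 - p 1)) =
      D * (u * (c 1 - b 1) - v * (c 0 - b 0)) := by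
    intro u v
    have : D = -x := by linarith
    rw [hl2, this, hx]
    linear_combination ((c 0 - b 0) * u + (c 1 - b 1) * v) * (h1 - h2)
  have e6 := e5 (w 0) (w 1)
  have : l * H * (l * (H⁻¹ * (w 0 * (q 0 - p 0) + w 1 * (q 1 - p 1)))) =
      l * H * (s * (w 0 * (c 1 - b 1) - w 1 * (c 0 - b 0))) := by
    have hc : H * H⁻¹ = 1 := mul_inv_cancel₀ hq.ne'
    calc _ = H * H⁻¹ * (l ^ 2 * (w 0 * (q 0 - p 0) + w 1 * (q 1 - p 1))) := by
            ring
      _ = _ := by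
        rw [hc, e6, e4]
        linear_combination -(D * (w 0 * (c 1 - b 1) - w 1 * (c 0 - b 0))) * hor2
  exact mul_left_cancel₀ (by positivity) this

/-! ### Triangles sharing an edge, and summation by edges -/

theorem mem_adj {σ : M.Edge} {K : M.Cell} : K ∈ M.adj σ ↔ ∃ i, M.edge K i = σ := by
  classical
  simp [adj]

theorem edge_injective (K : M.Cell) : Function.Injective (M.edge K) := by
  intro i j h
  have h1 := congrArg Subtype.val h
  simp only [edge, edgePair, Sym2.eq_iff, (points_injective (M.cell K)).eq_iff] at h1
  revert h1
  fin_cases i <;> fin_cases j <;> decide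

theorem normal_edge (K : M.Cell) (i : Fin 3) : M.normal K (M.edge K i) = M.outward K i := by
  classical
  simp [normal, (M.edge_injective K).eq_iff]

theorem len_mul_inner_normal (K : M.Cell) (i : Fin 3) (w : Plane) :
    M.len (M.edge K i) * inner ℝ w (M.normal K (M.edge K i)) = M.orient K *
      cross w ((M.cell K).points (i + 2) - (M.cell K).points (i + 1)) := by
  rw [normal_edge, len_mul_inner_outward]

theorem range_points (K : M.Cell) (i : Fin 3) : range (M.cell K).points =
    {(M.cell K).points i, (M.cell K).points (i + 1), (M.cell K).points (i + 2)} := by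
  ext x
  simp only [mem_range, mem_insert_iff, mem_singleton_iff]
  constructor
  · rintro ⟨j, rfl⟩
    fin_cases i <;> fin_cases j <;> simp
  · rintro (h | h | h) <;> exact ⟨_, h.symm⟩

/-- Two triangles of the mesh lie on different sides of a common edge. -/
theorem cross_mul_cross_neg {K L : M.Cell} (hKL : K ≠ L) {a a' b c : Plane}
    (hK : range (M.cell K).points = {a, b, c}) (hL : range (M.cell L).points = {a', b, c})
    (h1 : cross (b - a) (c - b) ≠ 0) (h2 : cross (b - a') (c - b) ≠ 0) :
    cross (b - a) (c - b) * cross (b - a') (c - b) < 0 := by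
  by_contra! hcon
  obtain ⟨x, hx, hx0⟩ := exists_mem_inter_of_same_side
    (lt_of_le_of_ne hcon (mul_ne_zero h1 h2).symm)
  have hconf := M.conforming K L
  rw [← Affine.Simplex.convexHull_eq_closedInterior, ← Affine.Simplex.convexHull_eq_closedInterior,
    hK, hL] at hconf
  rw [hconf] at hx
  have haa : a ≠ a' := by
    rintro rfl
    exact hKL (M.vertices_injective (hK.trans hL.symm))
  -- The common vertices, hence their convex hull, lie on the line `bc`, whereas `x` does not.
  have hsub : ({a, b, c} ∩ {a', b, c} : Set Plane) ⊆ {y | cross (y - b) (c - b) = 0} := by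
    rintro y ⟨hy, hy'⟩
    simp only [mem_insert_iff, mem_singleton_iff] at hy hy'
    rcases hy with rfl | rfl | rfl
    · rcases hy' with rfl | rfl | rfl
      · exact absurd rfl haa
      · simp [cross]
      · simp [cross, mul_comm]
    · simp [cross]
    · simp [cross, mul_comm]
  have hconv : Convex ℝ {y : Plane | cross (y - b) (c - b) = 0} := by
    intro y hy z hz s t _ _ hst
    simp only [mem_ofPred_eq, cross, PiLp.sub_apply, PiLp.add_apply, PiLp.smul_apply,
      smul_eq_mul] at hy hz ⊢
    linear_combination s * hy + t * hz + (b 0 * (c 1 - b 1) - b 1 * (c 0 - b 0)) * hst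
  exact hx0 (convexHull_min hsub hconv hx)

/-- Both normals are the same rotated edge up to sign. If the triangles list the edge in the same
direction, lying on opposite sides forces opposite orientations. If they list it in opposite
directions, the orientations agree and the edge vector changes sign. -/
theorem normal_eq_neg {K L : M.Cell} (hKL : K ≠ L) {σ : M.Edge} (hK : K ∈ M.adj σ)
    (hL : L ∈ M.adj σ) : M.normal L σ = -M.normal K σ := by
  obtain ⟨i, rfl⟩ := M.mem_adj.1 hK
  obtain ⟨j, hj⟩ := M.mem_adj.1 hL
  refine ext_inner_left ℝ fun w => ?_
  apply mul_left_cancel₀ (M.len_pos (M.edge K i)).ne'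
  rw [inner_neg_right, mul_neg, len_mul_inner_normal, ← hj, len_mul_inner_normal]
  have hdK := det_eq_cross (M.cell K) i
  have hdL := det_eq_cross (M.cell L) j
  have hsK := M.orient_mul_det K
  have hsL := M.orient_mul_det L
  have h0K := det_ne_zero (M.cell K)
  have h0L := det_ne_zero (M.cell L)
  have hs2K := M.orient_mul_self K
  have hs2L := M.orient_mul_self L
  have hrK := M.range_points K i
  have hrL := M.range_points L j
  have hp := congrArg Subtype.val hj
  simp only [edge, edgePair, Sym2.eq_iff] at hp
  rcases hp with ⟨e1, e2⟩ | ⟨e1, e2⟩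
  · rw [e1, e2] at hrL hdL ⊢
    rw [hdK] at h0K
    rw [hdL] at h0L
    have h := M.cross_mul_cross_neg hKL hrK hrL h0K h0L
    rw [← hdK, ← hdL] at h
    rw [← hdK] at h0K
    rw [← hdL] at h0L
    have : M.orient L = -M.orient K := by
      have h3 : M.orient K * M.orient L * (det (M.cell K) * det (M.cell L)) =
          -(det (M.cell K) * det (M.cell L)) := by
        rw [← abs_of_neg h, abs_mul, ← hsK, ← hsL]; ring
      have h4 : M.orient K * M.orient L = -1 :=
        mul_right_cancel₀ (mul_ne_zero h0K h0L) (by rw [h3]; ring)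
      linear_combination M.orient K * h4 - M.orient L * hs2K
    rw [this]; ring
  · rw [e1, e2] at hrL hdL ⊢
    rw [pair_comm] at hrL
    set a := (M.cell K).points i
    set a' := (M.cell L).points j
    set b := (M.cell K).points (i + 1)
    set c := (M.cell K).points (i + 2)
    have hdL' : det (M.cell L) = -cross (b - a') (c - b) := by
      rw [hdL]; simp only [cross, PiLp.sub_apply]; ring
    have h := M.cross_mul_cross_neg hKL hrK hrL (by rwa [← hdK])
      (by rw [← neg_ne_zero, ← hdL']; exact h0L)
    have h' : 0 < det (M.cell K) * det (M.cell L) := by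
      rw [hdK, hdL']; linarith
    have : M.orient L = M.orient K := by
      have h3 : M.orient K * M.orient L * (det (M.cell K) * det (M.cell L)) =
          det (M.cell K) * det (M.cell L) := by
        conv_rhs => rw [← abs_of_pos h', abs_mul, ← hsK, ← hsL]
        ring
      have h4 : M.orient K * M.orient L = 1 :=
        mul_right_cancel₀ (mul_ne_zero h0K h0L) (by rw [h3]; ring)
      linear_combination M.orient K * h4 - M.orient L * hs2K
    rw [this]
    simp only [cross, PiLp.sub_apply]; ring

theorem normal_ne_zero {K : M.Cell} {σ : M.Edge} (hK : K ∈ M.adj σ) : M.normal K σ ≠ 0 := by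
  obtain ⟨i, rfl⟩ := M.mem_adj.1 hK
  intro h
  have := M.len_mul_inner_normal K i ((M.cell K).points (i + 1) - (M.cell K).points i)
  rw [h, inner_zero_right, mul_zero, ← det_eq_cross, orient_mul_det] at this
  exact det_ne_zero _ (abs_eq_zero.1 this.symm)

theorem cellK_mem (σ : M.Edge) : M.cellK σ ∈ M.adj σ := Finset.min'_mem _ _

theorem cellL_mem (σ : M.Edge) : M.cellL σ ∈ M.adj σ := Finset.max'_mem _ _

variable {M}

theorem IsInterior.cellK_ne_cellL {σ : M.Edge} (h : M.IsInterior σ) : M.cellK σ ≠ M.cellL σ :=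
  (Finset.min'_lt_max'_of_card _ h).ne

/-- Three triangles on one edge would have pairwise opposite normals, so a normal would equal its
own negative. -/
theorem IsInterior.eq_or_eq {σ : M.Edge} (h : M.IsInterior σ) {K : M.Cell} (hK : K ∈ M.adj σ) :
    K = M.cellK σ ∨ K = M.cellL σ := by
  by_contra! hcon
  have h1 := M.normal_eq_neg hcon.1 hK (M.cellK_mem σ)
  have h2 := M.normal_eq_neg hcon.2 hK (M.cellL_mem σ)
  have h3 := M.normal_eq_neg h.cellK_ne_cellL (M.cellK_mem σ) (M.cellL_mem σ)
  rw [h1, h2, neg_neg] at h3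
  refine M.normal_ne_zero hK ((smul_eq_zero_iff_right (two_ne_zero (α := ℝ))).1 ?_)
  rw [two_smul]
  nth_rewrite 1 [← h3]
  exact neg_add_cancel _

theorem IsInterior.adj_eq {σ : M.Edge} (h : M.IsInterior σ) :
    M.adj σ = {M.cellK σ, M.cellL σ} := by
  ext K
  simp only [Finset.mem_insert, Finset.mem_singleton]
  refine ⟨h.eq_or_eq, ?_⟩
  rintro (rfl | rfl)
  exacts [M.cellK_mem σ, M.cellL_mem σ]

theorem IsInterior.normal_cellL {σ : M.Edge} (h : M.IsInterior σ) :
    M.normal (M.cellL σ) σ = -M.normal (M.cellK σ) σ :=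
  M.normal_eq_neg h.cellK_ne_cellL (M.cellK_mem σ) (M.cellL_mem σ)

theorem IsInterior.other_cellL {σ : M.Edge} (h : M.IsInterior σ) :
    M.other (M.cellL σ) σ = M.cellK σ := if_neg h.cellK_ne_cellL.symm

variable (M)

theorem other_cellK (σ : M.Edge) : M.other (M.cellK σ) σ = M.cellL σ := if_pos rfl

theorem adj_eq_singleton {σ : M.Edge} (h : ¬ M.IsInterior σ) : M.adj σ = {M.cellK σ} := by
  have hc : (M.adj σ).card = 1 :=
    le_antisymm (not_lt.1 h) (Finset.card_pos.2 (M.adj_nonempty σ))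
  obtain ⟨K, hK⟩ := Finset.card_eq_one.1 hc
  have := M.cellK_mem σ
  rw [hK] at this ⊢
  rw [Finset.mem_singleton.1 this]

open Classical in
/-- Rearrangement by edges of a sum over the edges of all the triangles. -/
theorem sum_cell_sum_edge (g : M.Cell → M.Edge → ℝ) :
    ∑ K, ∑ i, g K (M.edge K i) =
      (∑ σ : M.Edge with M.IsInterior σ, (g (M.cellK σ) σ + g (M.cellL σ) σ)) +
        ∑ σ : M.Edge with ¬ M.IsInterior σ, g (M.cellK σ) σ := by
  have h1 : ∀ K, ∑ i, g K (M.edge K i) = ∑ σ : M.Edge, if K ∈ M.adj σ then g K σ else 0 := by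
    intro K
    rw [← Finset.sum_filter]
    have : Finset.univ.filter (fun σ => K ∈ M.adj σ) = Finset.univ.image (M.edge K) := by
      ext σ; simp [mem_adj]
    rw [this, Finset.sum_image fun i _ j _ h => M.edge_injective K h]
  simp_rw [h1]
  rw [Finset.sum_comm, ← Finset.sum_filter_add_sum_filter_not Finset.univ
    (fun σ => M.IsInterior σ)]
  congr 1
  · refine Finset.sum_congr rfl fun σ hσ => ?_
    have hσ := (Finset.mem_filter.1 hσ).2
    rw [Finset.sum_ite_mem, Finset.univ_inter, hσ.adj_eq, Finset.sum_pair hσ.cellK_ne_cellL]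
  · refine Finset.sum_congr rfl fun σ hσ => ?_
    have hσ := (Finset.mem_filter.1 hσ).2
    rw [Finset.sum_ite_mem, Finset.univ_inter, M.adj_eq_singleton hσ, Finset.sum_singleton]

/-! ### Gradients and fluxes on one triangle -/

theorem mid_edge (K : M.Cell) (i : Fin 3) : M.mid (M.edge K i) =
    midpoint ℝ ((M.cell K).points (i + 1)) ((M.cell K).points (i + 2)) := by
  simp [mid, edge, edgePair]

theorem sub_eq_inner_grad (q : M.P1) (K : M.Cell) :
    ∀ x y, q K x - q K y = inner ℝ (x - y) (M.grad q K) := by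
  set l := LinearMap.toContinuousLinearMap (q K).linear with hl
  have hg : ∀ x, ∇ (q K) x = (InnerProductSpace.toDual ℝ Plane).symm l := by
    intro x
    have : HasFDerivAt (q K) l x := by
      have h : (q K : Plane → ℝ) = fun x => l x + q K 0 := by
        ext y
        have := congrFun (q K).decomp y
        simpa [hl] using this
      rw [h]
      exact l.hasFDerivAt.add_const _
    rw [gradient, this.fderiv]
  have hgr : M.grad q K = (InnerProductSpace.toDual ℝ Plane).symm l := by
    rw [grad]
    simp_rw [hg]
    rw [setIntegral_const, smul_smul]
    change ((M.area K)⁻¹ * M.area K) • _ = _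
    rw [inv_mul_cancel₀ (M.area_pos K).ne', one_smul]
  intro x y
  rw [hgr, real_inner_comm, InnerProductSpace.toDual_symm_apply, hl,
    LinearMap.coe_toContinuousLinearMap', ← vsub_eq_sub x y, AffineMap.linearMap_vsub, vsub_eq_sub]

theorem area_eq (K : M.Cell) : M.area K = |det (M.cell K)| * refArea :=
  measureReal_closedInterior _

/-- Green's formula on a triangle. -/
theorem area_mul_inner_grad (q : M.P1) (K : M.Cell) (w : Plane) :
    M.area K * inner ℝ w (M.grad q K) = 2 * refArea *
      ∑ i, M.len (M.edge K i) * (q K (M.mid (M.edge K i)) *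
        inner ℝ w (M.normal K (M.edge K i))) := by
  have h : ∀ i, M.len (M.edge K i) * (q K (M.mid (M.edge K i)) *
      inner ℝ w (M.normal K (M.edge K i))) = M.orient K *
        ((q K ((M.cell K).points 0) +
          inner ℝ (M.mid (M.edge K i) - (M.cell K).points 0) (M.grad q K)) *
          cross w ((M.cell K).points (i + 2) - (M.cell K).points (i + 1))) := by
    intro i
    rw [mul_left_comm, len_mul_inner_normal, ← M.sub_eq_inner_grad]
    ring
  simp_rw [h, mid_edge]
  -- With areas and normals written through determinants, the claim is a polynomial identity in the
  -- vertex coordinates, with `refArea` a common factor.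
  rw [area_eq, ← orient_mul_det]
  simp only [Fin.sum_univ_three, midpoint_eq_smul_add, inner_eq, cross, det, Fin.isValue,
    PiLp.sub_apply, PiLp.add_apply, PiLp.smul_apply, smul_eq_mul, zero_add, invOf_eq_inv,
    show (1 + 1 : Fin 3) = 2 from rfl, show (1 + 2 : Fin 3) = 0 from rfl,
    show (2 + 1 : Fin 3) = 0 from rfl, show (2 + 2 : Fin 3) = 1 from rfl]
  ring

/-- The fluxes of a constant field through the edges of a triangle cancel. -/
theorem sum_len_mul_inner_normal (K : M.Cell) (w : Plane) :
    ∑ i, M.len (M.edge K i) * inner ℝ w (M.normal K (M.edge K i)) = 0 := by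
  simp_rw [len_mul_inner_normal]
  simp only [Fin.sum_univ_three, cross, PiLp.sub_apply, zero_add,
    show (1 + 1 : Fin 3) = 2 from rfl, show (1 + 2 : Fin 3) = 0 from rfl,
    show (2 + 1 : Fin 3) = 0 from rfl, show (2 + 2 : Fin 3) = 1 from rfl]
  ring

/-! ### Discrete integration by parts -/

/-- The `L²` inner product of piecewise constant fields. -/
def ip (v w : M.P0) : ℝ := ∑ K, M.area K * inner ℝ (v K) (w K)

theorem ip_comm (v w : M.P0) : M.ip v w = M.ip w v := by
  simp only [ip, real_inner_comm]

theorem ip_add_left (v v' w : M.P0) : M.ip (v + v') w = M.ip v w + M.ip v' w := by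
  simp only [ip, Pi.add_apply, inner_add_left, mul_add, Finset.sum_add_distrib]

theorem ip_sub_left (v v' w : M.P0) : M.ip (v - v') w = M.ip v w - M.ip v' w := by
  simp only [ip, Pi.sub_apply, inner_sub_left, mul_sub, Finset.sum_sub_distrib]

theorem ip_smul_left (c : ℝ) (v w : M.P0) : M.ip (c • v) w = c * M.ip v w := by
  simp only [ip, Pi.smul_apply, real_inner_smul_left, mul_left_comm _ c, Finset.mul_sum]

theorem ip_add_right (v w w' : M.P0) : M.ip v (w + w') = M.ip v w + M.ip v w' := by
  rw [ip_comm, ip_add_left, ip_comm, M.ip_comm w']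

theorem ip_sub_right (v w w' : M.P0) : M.ip v (w - w') = M.ip v w - M.ip v w' := by
  rw [ip_comm, ip_sub_left, ip_comm, M.ip_comm w']

theorem ip_smul_right (c : ℝ) (v w : M.P0) : M.ip v (c • w) = c * M.ip v w := by
  rw [ip_comm, ip_smul_left, ip_comm]

theorem l2norm_sq (v : M.P0) : M.l2norm v ^ 2 = M.ip v v := by
  rw [l2norm, Real.sq_sqrt
    (Finset.sum_nonneg fun K _ => mul_nonneg (M.area_pos K).le (sq_nonneg _))]
  simp only [ip, real_inner_self_eq_norm_sq]

theorem l2norm_nonneg (v : M.P0) : 0 ≤ M.l2norm v := Real.sqrt_nonneg _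

theorem ip_self_nonneg (v : M.P0) : 0 ≤ M.ip v v := M.l2norm_sq v ▸ sq_nonneg _

theorem ip_le (v w : M.P0) : M.ip v w ≤ M.l2norm v * M.l2norm w := by
  refine le_trans (Finset.sum_le_sum fun K _ => ?_)
    (Real.sum_mul_le_sqrt_mul_sqrt Finset.univ (fun K => √(M.area K) * ‖v K‖)
      fun K => √(M.area K) * ‖w K‖) |>.trans_eq ?_
  · rw [mul_mul_mul_comm, Real.mul_self_sqrt (M.area_pos K).le]
    exact mul_le_mul_of_nonneg_left (real_inner_le_norm _ _) (M.area_pos K).le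
  · simp only [mul_pow, Real.sq_sqrt (M.area_pos _).le, l2norm]

/-- Green's formula turns the product into edge terms. On an interior edge the flux and the midpoint
value agree from both sides while the normals are opposite. On an exterior edge the flux vanishes.
-/
theorem ip_grad_eq_zero {u : M.P0} (hu : M.IsRT0 u) {q : M.P1} (hq : M.IsP1nc q) :
    M.ip u (M.grad q) = 0 := by
  classical
  simp only [ip, area_mul_inner_grad]
  rw [← Finset.mul_sum, M.sum_cell_sum_edge fun K σ =>
    M.len σ * (q K (M.mid σ) * inner ℝ (u K) (M.normal K σ))]
  rw [Finset.sum_eq_zero, Finset.sum_eq_zero, add_zero, mul_zero]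
  · intro σ hσ
    rw [(hu σ).2 (Finset.mem_filter.1 hσ).2, mul_zero, mul_zero]
  · intro σ hσ
    have hσ := (Finset.mem_filter.1 hσ).2
    rw [hσ.normal_cellL, inner_neg_right, (hu σ).1 hσ, hq σ hσ]
    ring

theorem div_sub_smul (v w : M.P0) (c : ℝ) (σ : M.Edge) :
    M.div (v - c • w) σ = M.div v σ - c * M.div w σ := by
  unfold div
  split_ifs
  · simp only [Pi.sub_apply, Pi.smul_apply, inner_sub_left, real_inner_smul_left]
    ring
  · simp only [Pi.sub_apply, Pi.smul_apply, inner_sub_left, real_inner_smul_left]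
    ring

/-- Each value of `div` is a nonzero multiple of the normal jump, or of the normal trace on the
boundary. -/
theorem isRT0_of_div_eq_zero {v : M.P0} (h : ∀ σ, M.div v σ = 0) : M.IsRT0 v := by
  intro σ
  have hσ := h σ
  have hl := M.len_pos σ
  have ha := M.area_pos (M.cellK σ)
  have ha' := M.area_pos (M.cellL σ)
  unfold div at hσ
  split_ifs at hσ with hi
  · refine ⟨fun _ => ?_, fun h => absurd hi h⟩
    have := (mul_eq_zero.1 hσ).resolve_left (by positivity)
    rw [inner_sub_left] at this
    linarith
  · exact ⟨fun h => absurd h hi, fun _ =>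
      (mul_eq_zero.1 (neg_eq_zero.1 hσ)).resolve_left (by positivity)⟩

theorem IsRT0.sub_smul {M : TriMesh Ω} {v w : M.P0} (hv : M.IsRT0 v) (hw : M.IsRT0 w) (c : ℝ) :
    M.IsRT0 (c • v - w) := by
  intro σ
  simp only [Pi.sub_apply, Pi.smul_apply, inner_sub_left, real_inner_smul_left]
  exact ⟨fun h => by rw [(hv σ).1 h, (hw σ).1 h], fun h => by rw [(hv σ).2 h, (hw σ).2 h]; simp⟩

theorem tau_nonneg (σ : M.Edge) : 0 ≤ M.tau σ := by
  refine _root_.div_nonneg (M.len_pos σ).le ?_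
  unfold d
  split_ifs <;> exact dist_nonneg

/-- The two sides of an interior edge add up to (v_L - v_K)·v_K + (v_K - v_L)·v_L = -|v_L - v_K|².
-/
theorem ip_lapTilde (v : M.P0) : M.ip (M.lapTilde v) v = -M.h1norm v ^ 2 := by
  classical
  obtain ⟨g, hg⟩ : ∃ g : M.Cell → M.Edge → ℝ, ∀ K σ, g K σ =
      if M.IsInterior σ then M.tau σ * inner ℝ (v (M.other K σ) - v K) (v K)
        else -(M.tau σ * ‖v K‖ ^ 2) := ⟨_, fun _ _ => rfl⟩
  have h1 : ∀ K, M.area K * inner ℝ (M.lapTilde v K) (v K) = ∑ i, g K (M.edge K i) := by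
    intro K
    simp only [hg]
    rw [lapTilde, ← smul_sub, real_inner_smul_left, ← mul_assoc,
      mul_inv_cancel₀ (M.area_pos K).ne', one_mul, inner_sub_left, sum_inner, sum_inner,
      Finset.sum_filter, Finset.sum_filter, ← Finset.sum_sub_distrib]
    refine Finset.sum_congr rfl fun i _ => ?_
    by_cases h : M.IsInterior (M.edge K i)
    · simp [h, real_inner_smul_left]
    · simp [h, real_inner_smul_left]
  rw [ip, Finset.sum_congr rfl fun K _ => h1 K, sum_cell_sum_edge, h1norm, Real.sq_sqrt
    (add_nonneg (Finset.sum_nonneg fun σ _ => mul_nonneg (M.tau_nonneg σ) (sq_nonneg _))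
      (Finset.sum_nonneg fun σ _ => mul_nonneg (M.tau_nonneg σ) (sq_nonneg _))),
    neg_add, ← Finset.sum_neg_distrib, ← Finset.sum_neg_distrib]
  congr 1
  · refine Finset.sum_congr (by congr) fun σ hσ => ?_
    have hσ := (Finset.mem_filter.1 hσ).2
    rw [hg, hg, if_pos hσ, if_pos hσ, other_cellK, hσ.other_cellL, ← real_inner_self_eq_norm_sq]
    simp only [inner_sub_left, inner_sub_right, real_inner_comm]
    ring
  · refine Finset.sum_congr (by congr) fun σ hσ => ?_
    rw [hg, if_neg (Finset.mem_filter.1 hσ).2]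

/-- On each triangle ½|v_K|² times the total flux of the constant u_K is zero and may be subtracted.
Each interior edge then contributes ½|σ||u·n||v_K - v_L|², and exterior edges contribute nothing. -/
theorem ip_bTilde_nonneg {u : M.P0} (hu : M.IsRT0 u) (v : M.P0) : 0 ≤ M.ip (M.bTilde u v) v := by
  classical
  obtain ⟨g, hg⟩ : ∃ g : M.Cell → M.Edge → ℝ, ∀ K σ, g K σ =
      (if M.IsInterior σ then M.len σ * (max (inner ℝ (u K) (M.normal K σ)) 0 * ‖v K‖ ^ 2 +
        min (inner ℝ (u K) (M.normal K σ)) 0 * inner ℝ (v (M.other K σ)) (v K)) else 0) -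
      1 / 2 * ‖v K‖ ^ 2 * (M.len σ * inner ℝ (u K) (M.normal K σ)) :=
    ⟨_, fun _ _ => rfl⟩
  have h1 : ∀ K, M.area K * inner ℝ (M.bTilde u v K) (v K) = ∑ i, g K (M.edge K i) := by
    intro K
    simp only [hg]
    rw [Finset.sum_sub_distrib, ← Finset.mul_sum, sum_len_mul_inner_normal, mul_zero, sub_zero,
      bTilde, real_inner_smul_left, ← mul_assoc,
      mul_inv_cancel₀ (M.area_pos K).ne', one_mul, sum_inner, Finset.sum_filter]
    refine Finset.sum_congr rfl fun i _ => ?_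
    by_cases h : M.IsInterior (M.edge K i)
    · simp only [h, if_true, real_inner_smul_left, inner_add_left, real_inner_self_eq_norm_sq]
    · simp [h]
  rw [ip, Finset.sum_congr rfl fun K _ => h1 K, sum_cell_sum_edge]
  refine add_nonneg (Finset.sum_nonneg fun σ hσ => ?_) (Finset.sum_nonneg fun σ hσ => ?_)
  · have hσ := (Finset.mem_filter.1 hσ).2
    have hp := sq_nonneg ‖v (M.cellK σ) - v (M.cellL σ)‖
    have hl := M.len_pos σ
    rw [hg, hg, if_pos hσ, if_pos hσ, other_cellK, hσ.other_cellL, hσ.normal_cellL, inner_neg_right,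
      ← (hu σ).1 hσ, real_inner_comm (v (M.cellK σ))]
    rw [norm_sub_sq_real] at hp
    set c : ℝ := inner ℝ (u (M.cellK σ)) (M.normal (M.cellK σ) σ)
    set x : ℝ := inner ℝ (v (M.cellK σ)) (v (M.cellL σ))
    rcases le_total 0 c with hc | hc
    · rw [max_eq_left hc, min_eq_right hc, max_eq_right (by linarith), min_eq_left (by linarith)]
      linarith [mul_nonneg (mul_nonneg hl.le hc) hp]
    · rw [max_eq_right hc, min_eq_left hc, max_eq_left (by linarith), min_eq_right (by linarith)]
      linarith [mul_nonneg (mul_nonneg hl.le (neg_nonneg.2 hc)) hp]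
  · have hσ := (Finset.mem_filter.1 hσ).2
    rw [hg, if_neg hσ, (hu σ).2 hσ]
    simp

/-! ### `L²` stability of the projection -/

theorem convex_cellSet (K : M.Cell) : Convex ℝ (M.cellSet K) := by
  rw [cellSet, ← Affine.Simplex.convexHull_eq_closedInterior]
  exact convex_convexHull ℝ _

/-- Closed triangles may leave the open set Ω at its boundary, but their interiors do not, and the
frontier of a convex set is null. -/
theorem restrict_cellSet (K : M.Cell) :
    volume.restrict (M.cellSet K) = volume.restrict (interior (M.cellSet K)) :=
  Measure.restrict_congr_set
    (interior_ae_eq_of_null_frontier ((M.convex_cellSet K).addHaar_frontier volume)).symm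

theorem interior_cellSet_subset (K : M.Cell) : interior (M.cellSet K) ⊆ Ω := by
  conv_rhs => rw [← M.interior_iUnion]
  exact interior_mono (subset_iUnion (fun K => (M.cell K).closedInterior) K)

theorem volume_convexHull_pair (b c : Plane) : volume (convexHull ℝ {b, c}) = 0 := by
  refine measure_mono_null (convexHull_subset_affineSpan _)
    (Measure.addHaar_affineSubspace volume _ fun h => ?_)
  have h1 := collinear_iff_finrank_le_one.1 (collinear_pair ℝ b c)
  rw [← direction_affineSpan, h, AffineSubspace.direction_top, finrank_top] at h1
  simp at h1

/-- Distinct triangles share at most two vertices, so they meet inside a null segment, and an open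
null set is empty. -/
theorem disjoint_interior_cellSet {K L : M.Cell} (hKL : K ≠ L) :
    Disjoint (interior (M.cellSet K)) (interior (M.cellSet L)) := by
  obtain ⟨i, hi⟩ : ∃ i, (M.cell K).points i ∉ range (M.cell L).points := by
    by_contra! hcon
    have h3 : ∀ J, (range (M.cell J).points).ncard = 3 := fun J => by
      rw [← image_univ, ncard_image_of_injective _ (points_injective _), ncard_univ]
      simp
    refine hKL (M.vertices_injective (eq_of_subset_of_ncard_le ?_ ?_ (finite_range _)))
    · rintro _ ⟨i, rfl⟩
      exact hcon i
    · rw [h3, h3]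
  have hsub : range (M.cell K).points ∩ range (M.cell L).points ⊆
      {(M.cell K).points (i + 1), (M.cell K).points (i + 2)} := by
    rintro x ⟨hx, hx'⟩
    rw [M.range_points K i] at hx
    rcases hx with rfl | hx
    · exact absurd hx' hi
    · exact hx
  have hnull : volume (interior (M.cellSet K) ∩ interior (M.cellSet L)) = 0 := by
    refine measure_mono_null ?_ (volume_convexHull_pair ((M.cell K).points (i + 1))
      ((M.cell K).points (i + 2)))
    refine (inter_subset_inter interior_subset interior_subset).trans ?_
    rw [cellSet, cellSet, M.conforming]
    exact convexHull_mono hsub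
  rw [disjoint_iff_inter_eq_empty]
  exact (isOpen_interior.inter isOpen_interior).measure_eq_zero_iff volume |>.1 hnull

/-- Jensen's inequality on each triangle, then summation over the disjoint interiors. -/
theorem l2norm_proj0_le (f : Lp Plane 2 (volume.restrict Ω)) : M.l2norm (M.proj0 f) ≤ ‖f‖ := by
  have hle : ∀ K, volume.restrict (M.cellSet K) ≤ volume.restrict Ω := fun K => by
    rw [restrict_cellSet]
    exact Measure.restrict_mono_set _ (M.interior_cellSet_subset K)
  have hsq : Integrable (fun x => ‖f x‖ ^ 2) (volume.restrict Ω) := by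
    simpa using L2.integrable_inner (𝕜 := ℝ) f f
  have hfin : ∀ K, volume (M.cellSet K) ≠ ⊤ := fun K =>
    (M.cell K).isCompact_closedInterior.measure_lt_top.ne
  have hcell : ∀ K, M.area K * ‖M.proj0 f K‖ ^ 2 ≤ ∫ x in M.cellSet K, ‖f x‖ ^ 2 := by
    intro K
    have : IsFiniteMeasure (volume.restrict (M.cellSet K)) :=
      ⟨by simpa using (hfin K).lt_top⟩
    have hconv : ConvexOn ℝ univ fun y : Plane => ‖y‖ ^ 2 :=
      convexOn_univ_norm.pow (fun _ _ => norm_nonneg _) 2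
    have h := hconv.map_set_average_le (f := f) (μ := volume) (t := M.cellSet K)
      (by fun_prop) isClosed_univ
      (fun h0 => (M.area_pos K).ne' (by rw [area, measureReal_def, h0, ENNReal.toReal_zero]))
      (hfin K) (by simp)
      (((Lp.memLp f).mono_measure (hle K)).integrable (by norm_num)) (hsq.mono_measure (hle K))
    rw [setAverage_eq, setAverage_eq, smul_eq_mul, inv_mul_eq_div] at h
    change ‖M.proj0 f K‖ ^ 2 ≤ _ / M.area K at h
    rwa [le_div_iff₀' (M.area_pos K)] at h
  have hnorm : ‖f‖ ^ 2 = ∫ x in Ω, ‖f x‖ ^ 2 := by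
    rw [← real_inner_self_eq_norm_sq, L2.inner_def]
    simp only [real_inner_self_eq_norm_sq]
  rw [← abs_of_nonneg (norm_nonneg f), ← abs_of_nonneg (M.l2norm_nonneg _), ← sq_le_sq, hnorm,
    l2norm, Real.sq_sqrt
    (Finset.sum_nonneg fun K _ => mul_nonneg (M.area_pos K).le (sq_nonneg _))]
  refine (Finset.sum_le_sum fun K _ => hcell K).trans ?_
  simp_rw [restrict_cellSet]
  rw [← integral_iUnion_fintype (fun K => isOpen_interior.measurableSet)
    (fun K L h => M.disjoint_interior_cellSet h)
    (fun K => (hsq.mono_measure (Measure.restrict_mono_set _ (M.interior_cellSet_subset K))))]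
  exact setIntegral_mono_set hsq (ae_of_all _ fun _ => sq_nonneg _)
    (ae_of_all _ (iUnion_subset M.interior_cellSet_subset))

/-! ### Energy estimate -/

theorem grad_sub (q r : M.P1) : M.grad (q - r) = M.grad q - M.grad r := by
  funext K
  refine ext_inner_left ℝ fun w => ?_
  have h1 := M.sub_eq_inner_grad (q - r) K w 0
  have h2 := M.sub_eq_inner_grad q K w 0
  have h3 := M.sub_eq_inner_grad r K w 0
  rw [sub_zero] at h1 h2 h3
  rw [Pi.sub_apply, inner_sub_right, ← h1, ← h2, ← h3]
  simp only [Pi.sub_apply, AffineMap.coe_sub]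
  ring

/-- The energy balance of one step of the BDF2 projection scheme. -/
theorem energy_step {Re k : ℝ} (hk : 0 < k) {u₀ u₁ u₂ v g : M.P0} {q₁ q₂ : M.P1}
    (hu₀ : M.IsRT0 u₀) (hu₁ : M.IsRT0 u₁) (hu₂ : M.IsRT0 u₂)
    (hq₁ : M.IsP1nc q₁) (hq₂ : M.IsP1nc q₂)
    (hmom : (2 * k)⁻¹ • ((3 : ℝ) • v - (4 : ℝ) • u₁ + u₀) - (1 / Re) • M.lapTilde v
      + M.bTilde ((2 : ℝ) • u₁ - u₀) v + M.grad q₁ = g)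
    (hproj : u₂ = v - (2 * k / 3) • M.grad (q₂ - q₁)) :
    M.ip u₂ u₂ + M.ip ((2 : ℝ) • u₂ - u₁) ((2 : ℝ) • u₂ - u₁) +
        4 * k ^ 2 / 3 * M.ip (M.grad q₂) (M.grad q₂) +
        4 * k ^ 2 / 3 * M.ip (M.grad q₂ - M.grad q₁) (M.grad q₂ - M.grad q₁) +
        4 * k / Re * M.h1norm v ^ 2 ≤
      M.ip u₁ u₁ + M.ip ((2 : ℝ) • u₁ - u₀) ((2 : ℝ) • u₁ - u₀) +
        4 * k ^ 2 / 3 * M.ip (M.grad q₁) (M.grad q₁) + 4 * k * M.ip g v := by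
  have hb := M.ip_bTilde_nonneg (hu₁.sub_smul hu₀ 2) v
  have h := congrArg (fun w => M.ip w v) hmom
  simp only [ip_add_left _ _ (M.grad q₁), ip_add_left _ _ (M.bTilde _ v),
    ip_sub_left _ _ ((1 / Re) • M.lapTilde v), ip_smul_left, ip_lapTilde] at h
  have hv : v = u₂ + (2 * k / 3) • (M.grad q₂ - M.grad q₁) := by
    rw [hproj, grad_sub]; abel
  have hδ := M.ip_self_nonneg (u₂ - (2 : ℝ) • u₁ + u₀)
  -- BDF2 identity 2(3a - 4b + c)·a = |a|² + |2a - b|² - |b|² - |2b - c|² + |a - 2b + c|². The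
  -- gradient part of `v` is orthogonal to the `RT₀` fields and adds only 6(2k/3)² = 8k²/3 times its
  -- square.
  have hS : 2 * M.ip ((3 : ℝ) • v - (4 : ℝ) • u₁ + u₀) v =
      M.ip u₂ u₂ + M.ip ((2 : ℝ) • u₂ - u₁) ((2 : ℝ) • u₂ - u₁) -
        M.ip u₁ u₁ - M.ip ((2 : ℝ) • u₁ - u₀) ((2 : ℝ) • u₁ - u₀) +
        M.ip (u₂ - (2 : ℝ) • u₁ + u₀) (u₂ - (2 : ℝ) • u₁ + u₀) +
        8 * k ^ 2 / 3 * M.ip (M.grad q₂ - M.grad q₁) (M.grad q₂ - M.grad q₁) := by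
    rw [hv]
    simp only [ip_add_left, ip_add_right, ip_sub_left, ip_sub_right, ip_smul_left, ip_smul_right,
      M.ip_comm (M.grad _) u₂,
      M.ip_grad_eq_zero hu₀ hq₁, M.ip_grad_eq_zero hu₀ hq₂, M.ip_grad_eq_zero hu₁ hq₁,
      M.ip_grad_eq_zero hu₁ hq₂, M.ip_grad_eq_zero hu₂ hq₁, M.ip_grad_eq_zero hu₂ hq₂,
      M.ip_comm u₁ u₀, M.ip_comm u₂ u₀, M.ip_comm u₂ u₁]
    ring
  -- From 2x·(y - x) = |y|² - |x|² - |y - x|². The negative square uses up half of the 8k²/3 in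
  -- `hS`.
  have hQ : 4 * k * M.ip (M.grad q₁) v = 4 * k ^ 2 / 3 * (M.ip (M.grad q₂) (M.grad q₂) -
      M.ip (M.grad q₁) (M.grad q₁) -
        M.ip (M.grad q₂ - M.grad q₁) (M.grad q₂ - M.grad q₁)) := by
    rw [hv]
    simp only [ip_add_right, ip_sub_left, ip_sub_right, ip_smul_right,
      M.ip_comm (M.grad _) u₂, M.ip_grad_eq_zero hu₂ hq₁, M.ip_comm (M.grad q₂) (M.grad q₁)]
    ring
  have hk1 : 4 * k * (2 * k)⁻¹ = 2 := by field_simp; norm_num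
  have h4 : 2 * M.ip ((3 : ℝ) • v - (4 : ℝ) • u₁ + u₀) v + 4 * k / Re * M.h1norm v ^ 2 +
      4 * k * M.ip (M.bTilde ((2 : ℝ) • u₁ - u₀) v) v + 4 * k * M.ip (M.grad q₁) v =
      4 * k * M.ip g v := by
    linear_combination 4 * k * h - M.ip ((3 : ℝ) • v - (4 : ℝ) • u₁ + u₀) v * hk1
  have := mul_nonneg (show 0 ≤ 4 * k by positivity) hb
  linarith

/-- If l > Y + d, then l² - dl = l(l - d) > Y², a contradiction. Iterated, it makes the square root
of the energy grow additively. -/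
theorem le_sq_of_le_add_mul {X Y d l : ℝ} (hY : 0 ≤ Y) (hd : 0 ≤ d) (hl : l ^ 2 ≤ X)
    (h : X ≤ Y ^ 2 + d * l) : l ≤ Y + d ∧ X ≤ (Y + d) ^ 2 := by
  have h1 : l ≤ Y + d := by
    by_contra! hc
    nlinarith [mul_nonneg hY hd]
  exact ⟨h1, by nlinarith [mul_le_mul_of_nonneg_left h1 hd, mul_nonneg hY hd]⟩

variable {M} {Re k : ℝ} {N : ℕ} {f : ℝ → Plane → Plane} {u ut : ℕ → M.P0} {p : ℕ → M.P1}

/-- Taking `div` of the projection step and inserting the pressure equation gives zero divergence.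
-/
theorem IsSolution.isRT0 (h : M.IsSolution Re k N f u ut p) (hk : 0 < k) :
    ∀ n ≤ N, M.IsRT0 (u n)
  | 0, _ => h.u_zero
  | 1, _ => h.u_one
  | n + 2, hn => by
    refine M.isRT0_of_div_eq_zero fun σ => ?_
    have h1 := h.pressure (n + 1) (by omega) hn σ
    rw [lap] at h1
    rw [h.projection (n + 1) (by omega) hn, div_sub_smul, h1]
    field_simp
    ring

theorem IsSolution.isP1nc (h : M.IsSolution Re k N f u ut p) :
    ∀ n, 1 ≤ n → n ≤ N → M.IsP1nc (p n)
  | 0, h1, _ => absurd h1 (by omega)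
  | 1, _, _ => h.p_one.1
  | n + 2, _, hn => (h.pressure_mem (n + 1) (by omega) hn).1

variable (M) in
/-- The discrete energy `|uⁿ|² + |2uⁿ - uⁿ⁻¹|² + (4k²/3) |∇pⁿ|²`. -/
def energy (k : ℝ) (u : ℕ → M.P0) (p : ℕ → M.P1) (n : ℕ) : ℝ :=
  M.ip (u n) (u n) + M.ip ((2 : ℝ) • u n - u (n - 1)) ((2 : ℝ) • u n - u (n - 1)) +
    4 * k ^ 2 / 3 * M.ip (M.grad (p n)) (M.grad (p n))

theorem ip_le_energy (n : ℕ) : M.ip (u n) (u n) ≤ M.energy k u p n := by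
  have h1 := M.ip_self_nonneg ((2 : ℝ) • u n - u (n - 1))
  have h2 := mul_nonneg (show 0 ≤ 4 * k ^ 2 / 3 by positivity) (M.ip_self_nonneg (M.grad (p n)))
  unfold energy
  linarith

theorem energy_one_le {C₀ : ℝ} (hk : 0 < k)
    (hC : M.l2norm (u 0) + M.l2norm (u 1) + k * M.l2norm (M.grad (p 1)) ≤ C₀) :
    M.energy k u p 1 ≤ (4 * C₀) ^ 2 := by
  have h0 := M.l2norm_nonneg (u 0)
  have h1 := M.l2norm_nonneg (u 1)
  have h2 := mul_nonneg hk.le (M.l2norm_nonneg (M.grad (p 1)))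
  -- Parallelogram law; the energy is then at most (1 + 8 + 2 + 4/3)C₀² ≤ 16C₀².
  have e : M.ip ((2 : ℝ) • u 1 - u 0) ((2 : ℝ) • u 1 - u 0) +
      M.ip ((2 : ℝ) • u 1 + u 0) ((2 : ℝ) • u 1 + u 0) =
      8 * M.l2norm (u 1) ^ 2 + 2 * M.l2norm (u 0) ^ 2 := by
    simp only [l2norm_sq, ip_add_left, ip_add_right, ip_sub_left, ip_sub_right, ip_smul_left,
      ip_smul_right]
    ring
  have e' := M.ip_self_nonneg ((2 : ℝ) • u 1 + u 0)
  have b0 : M.l2norm (u 0) ^ 2 ≤ C₀ ^ 2 := pow_le_pow_left₀ h0 (by linarith) 2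
  have b1 : M.l2norm (u 1) ^ 2 ≤ C₀ ^ 2 := pow_le_pow_left₀ h1 (by linarith) 2
  have b2 : (k * M.l2norm (M.grad (p 1))) ^ 2 ≤ C₀ ^ 2 := pow_le_pow_left₀ h2 (by linarith) 2
  rw [mul_pow, l2norm_sq] at b2
  have e3 := M.l2norm_sq (u 1)
  simp only [energy, Nat.sub_self]
  nlinarith

/-- Here `n` counts steps from level 1. The first bound is the growth of the square root. The second
sums the energy balances, keeping the dissipation. -/
theorem IsSolution.energy_bound (h : M.IsSolution Re k N f u ut p) (hk : 0 < k) (hRe : 0 < Re)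
    {A F : ℝ} (hA : 0 ≤ A) (hF : 0 ≤ F) (h1 : M.energy k u p 1 ≤ A ^ 2)
    (hf : ∀ n : ℕ, n ≤ N → M.l2norm (M.proj0 (f (n * k))) ≤ F) (n : ℕ) (hn : n + 1 ≤ N) :
    M.energy k u p (n + 1) ≤ (A + 4 * k * F * n) ^ 2 ∧
      M.energy k u p (n + 1) + 4 / Re * (k * ∑ j ∈ Finset.Icc 2 (n + 1), M.h1norm (ut j) ^ 2) ≤
        A ^ 2 + 4 * k * F * n * (A + 4 * k * F * n) := by
  induction n with
  | zero => simpa using h1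
  | succ n ih =>
    obtain ⟨ih1, ih2⟩ := ih (by omega)
    have hn1 : 1 ≤ n + 1 := by omega
    have hs := M.energy_step hk (h.isRT0 hk _ (by omega)) (h.isRT0 hk (n + 1) (by omega))
      (h.isRT0 hk (n + 2) hn) (h.isP1nc (n + 1) hn1 (by omega)) (h.isP1nc (n + 2) (by omega) hn)
      (h.momentum (n + 1) hn1 hn) (h.projection (n + 1) hn1 hn)
    have hu := h.isRT0 hk (n + 2) hn
    have hv : ut (n + 2) = u (n + 2) + (2 * k / 3) • (M.grad (p (n + 2)) - M.grad (p (n + 1))) := by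
      rw [h.projection (n + 1) hn1 hn, grad_sub]; abel
    set G := M.grad (p (n + 2)) - M.grad (p (n + 1)) with hG
    have hor : M.ip (u (n + 2)) G = 0 := by
      rw [hG, ← grad_sub, ip_grad_eq_zero]
      · exact hu
      · intro σ hσ
        simp only [Pi.sub_apply, AffineMap.coe_sub]
        rw [h.isP1nc (n + 2) (by omega) hn σ hσ, h.isP1nc (n + 1) hn1 (by omega) σ hσ]
    -- The forcing is tested with ũ, not u; the extra 4k²/9 is absorbed by the 4k²/3 left in the
    -- energy balance.
    have hsq : M.l2norm (ut (n + 2)) ^ 2 = M.ip (u (n + 2)) (u (n + 2)) +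
        4 * k ^ 2 / 9 * M.ip G G := by
      rw [l2norm_sq, hv]
      simp only [ip_add_left, ip_add_right, ip_smul_left, ip_smul_right, M.ip_comm G, hor]
      ring
    have hgn := mul_nonneg (sq_nonneg k) (M.ip_self_nonneg G)
    have hE := ip_le_energy (k := k) (u := u) (p := p) (n + 2)
    have hl := M.l2norm_nonneg (ut (n + 2))
    have hgl : M.ip (M.proj0 (f ((n + 1 + 1 : ℕ) * k))) (ut (n + 2)) ≤
        F * M.l2norm (ut (n + 2)) :=
      (M.ip_le _ _).trans (mul_le_mul_of_nonneg_right (hf _ hn) hl)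
    have hgl' := mul_le_mul_of_nonneg_left hgl (show 0 ≤ 4 * k by positivity)
    have hh : 0 ≤ 4 * k / Re * M.h1norm (ut (n + 2)) ^ 2 := by positivity
    have hs' : M.energy k u p (n + 2) + 4 * k ^ 2 / 3 * M.ip G G +
        4 * k / Re * M.h1norm (ut (n + 2)) ^ 2 ≤
        M.energy k u p (n + 1) + 4 * k * (F * M.l2norm (ut (n + 2))) :=
      hs.trans (add_le_add_right hgl' _)
    have hY : 0 ≤ A + 4 * k * F * n := by positivity
    have hd : 0 ≤ 4 * k * F := by positivity
    obtain ⟨hl1, hX⟩ := le_sq_of_le_add_mul (X := M.energy k u p (n + 2) + 4 * k ^ 2 / 3 * M.ip G G)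
      hY hd (l := M.l2norm (ut (n + 2))) (by rw [hsq]; linarith) (by linarith)
    have hcast : A + 4 * k * F * (n + 1 : ℕ) = A + 4 * k * F * n + 4 * k * F := by
      push_cast; ring
    refine ⟨?_, ?_⟩
    · rw [hcast]
      exact le_trans (by linarith) hX
    · rw [hcast, Finset.sum_Icc_succ_top (by omega)]
      have hd2 := mul_le_mul_of_nonneg_left hl1 hd
      -- With d = 4kF this is the slack dn·d in dn(A + dn) + d(A + d(n+1)) ≤ d(n+1)(A + d(n+1)).
      have hnn := mul_nonneg (mul_nonneg hd (Nat.cast_nonneg (α := ℝ) n)) hd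
      have e1 : 4 / Re * (k * (∑ j ∈ Finset.Icc 2 (n + 1), M.h1norm (ut j) ^ 2 +
          M.h1norm (ut (n + 1 + 1)) ^ 2)) =
          4 / Re * (k * ∑ j ∈ Finset.Icc 2 (n + 1), M.h1norm (ut j) ^ 2) +
          4 * k / Re * M.h1norm (ut (n + 2)) ^ 2 := by ring
      rw [e1]
      push_cast
      linarith

end TriMesh
end FVScheme

end

/-! ### The stability theorem -/

theorem theorem5p1 (Ω : Set FVScheme.Plane) (T Re : ℝ) (hT : 0 < T) (hRe : 0 < Re)
    (f : ℝ → Lp FVScheme.Plane 2 ((volume : Measure FVScheme.Plane).restrict Ω))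
    (hf : ContinuousOn (fun t => ‖f t‖) (Icc 0 T)) (C₀ : ℝ) :
    ∃ C : ℝ, 0 < C ∧
      ∀ (M : FVScheme.TriMesh Ω) (N : ℕ) (k : ℝ), 0 < k → N * k ≤ T →
      ∀ (u ut : ℕ → M.P0) (p : ℕ → M.P1),
        M.IsSolution Re k N (fun t => f t) u ut p →
        M.l2norm (u 0) + M.l2norm (u 1) + k * M.l2norm (M.grad (p 1)) ≤ C₀ →
        ∀ m : ℕ, 2 ≤ m → m ≤ N →
          M.l2norm (u m) ^ 2 + k * ∑ n ∈ Finset.Icc 2 m, M.h1norm (ut n) ^ 2 ≤ C := by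
  obtain ⟨F, hF⟩ := isCompact_Icc.bddAbove_image hf
  have hF : ∀ t ∈ Icc 0 T, ‖f t‖ ≤ F := fun t ht => hF (mem_image_of_mem _ ht)
  have hF0 : 0 ≤ F := (norm_nonneg _).trans (hF 0 ⟨le_rfl, hT.le⟩)
  -- The bracket bounds energy plus 4/Re times the dissipation, so it is counted once for |uᵐ|² and
  -- Re/4 times for the sum. The `+ 1` and `|C₀|` ensure positivity for every real `C₀`.
  refine ⟨(1 + Re / 4) * ((4 * |C₀|) ^ 2 + 4 * T * F * (4 * |C₀| + 4 * T * F)) + 1,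
    by positivity, ?_⟩
  intro M N k hk hNk u ut p h hC m hm hmN
  obtain ⟨n, rfl⟩ : ∃ n, m = n + 1 := ⟨m - 1, by omega⟩
  have hE1 := FVScheme.TriMesh.energy_one_le hk hC
  rw [← sq_abs, abs_mul, abs_of_pos (four_pos (α := ℝ))] at hE1
  have hnT : ∀ j : ℕ, j ≤ N → j * k ≤ T := fun j hj =>
    (mul_le_mul_of_nonneg_right (Nat.cast_le.2 hj) hk.le).trans hNk
  obtain ⟨-, hb⟩ := h.energy_bound hk hRe (by positivity) hF0 hE1 (fun j hj =>
    (M.l2norm_proj0_le _).trans (hF _ ⟨by positivity, hnT j hj⟩)) n hmN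
  have hkn : 4 * k * F * n ≤ 4 * T * F := by
    have := mul_le_mul_of_nonneg_right (hnT n (by omega)) hF0
    linarith
  have hkn0 : 0 ≤ 4 * k * F * n := by positivity
  have hu := FVScheme.TriMesh.ip_le_energy (k := k) (u := u) (p := p) (n + 1)
  rw [← M.l2norm_sq] at hu
  set S := k * ∑ j ∈ Finset.Icc 2 (n + 1), M.h1norm (ut j) ^ 2 with hS
  have hS0 : 0 ≤ S := by positivity
  set B := (4 * |C₀|) ^ 2 + 4 * T * F * (4 * |C₀| + 4 * T * F) with hB
  have hB' : M.l2norm (u (n + 1)) ^ 2 + 4 / Re * S ≤ B := by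
    refine (add_le_add_left hu _).trans (hb.trans ?_)
    rw [hB]
    gcongr
  have h3 : 0 ≤ M.l2norm (u (n + 1)) ^ 2 := sq_nonneg _
  have h4 : 4 / Re * S ≤ B := by linarith
  have h5 : S ≤ Re / 4 * B := by
    calc S = Re / 4 * (4 / Re * S) := by field_simp
      _ ≤ Re / 4 * B := by gcongr
  have h6 : 0 ≤ 4 / Re * S := by positivity
  linarith
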